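/- Let $\{S_n\}_{n\in\mathbb N}$ be a sequence of densely defined closed symmetric operators in complex Hilbert spaces $\mathfrak H_n$, and suppose that $S_n\ge 0$ for every $n$, i.e. $(S_nf,f)\ge 0$ for $f\in\operatorname{dom}(S_n)$. For operators $T_n$ in $\mathfrak H_n$ let $\bigoplus_n T_n$ denote the operator in the Hilbert space direct sum $\mathfrak H=\bigoplus_n\mathfrak H_n$ with domain $$\Big\{f=(f_n)\in\mathfrak H:\ f_n\in\operatorname{dom}(T_n)\text{ for all }n,\ \sum_n\|T_nf_n\|^2<\infty\Big\}$$ and action $(f_n)\mapsto(T_nf_n)$. Put $A:=\bigoplus_n S_n$. For a densely defined closed non-negative symmetric operator $T$, let $\mathrm{Ext}_T(0,\infty)$ be the set of its non-negative self-adjoint extensions. The Friedrichs extension $T^F$ and the Krein extension $T^K$ of $T$ are the elements of $\mathrm{Ext}_T(0,\infty)$ determined by $$(T^F+x)^{-1}\le(\widetilde T+x)^{-1}\le(T^K+x)^{-1},\qquad x>0,\quad \widetilde T\in\mathrm{Ext}_T(0,\infty).$$ Then each $S_n$ has exactly one Friedrichs extension $S_n^F$ and exactly one Krein extension $S_n^K$,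 the same holds for $A$, and $$A^F=\bigoplus_{n=1}^\infty S_n^F\qquad\text{and}\qquad A^K=\bigoplus_{n=1}^\infty S_n^K.$$ -/

import Mathlib

open scoped InnerProductSpace ENNReal

namespace NonnegExt

noncomputable section

/-- The orthogonal (Hilbert) direct sum `⊕ Sₙ` of operators `Sₙ` in `Hₙ`, acting in the Hilbert
sum `⊕ Hₙ = lp H 2`.  A vector `f = (fₙ)` is in the domain iff `fₙ ∈ dom Sₙ` for all `n` and
`∑ ‖Sₙ fₙ‖² < ∞` (together with `∑ ‖fₙ‖² < ∞`, this says that `f` is in the Hilbert sum of the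
spaces `dom Sₙ` with their graph norms); then `(⊕ Sₙ) f = (Sₙ fₙ)`. -/
def directSum {H : ℕ → Type*} [∀ n, NormedAddCommGroup (H n)]
    [∀ n, InnerProductSpace ℂ (H n)] (S : ∀ n, H n →ₗ.[ℂ] H n) :
    lp H 2 →ₗ.[ℂ] lp H 2 where
  domain :=
    { carrier := {f | ∃ h : ∀ n, f n ∈ (S n).domain, Memℓp (fun n => S n ⟨f n, h n⟩) 2}
      zero_mem' := by
        refine ⟨fun n => (S n).domain.zero_mem, ?_⟩
        have : (fun n => S n ⟨(0 : lp H 2) n, (S n).domain.zero_mem⟩) = 0 := by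
          funext n
          exact (S n).map_zero
        rw [this]
        exact zero_memℓp
      add_mem' := by
        rintro f g ⟨hf, hf'⟩ ⟨hg, hg'⟩
        refine ⟨fun n => (S n).domain.add_mem (hf n) (hg n), ?_⟩
        have := hf'.add hg'
        convert this using 1
        funext n
        exact (S n).map_add ⟨f n, hf n⟩ ⟨g n, hg n⟩
      smul_mem' := by
        rintro c f ⟨hf, hf'⟩
        refine ⟨fun n => (S n).domain.smul_mem c (hf n), ?_⟩
        have := hf'.const_smul c
        convert this using 1
        funext n
        exact (S n).map_smul c ⟨f n, hf n⟩ }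
  toFun :=
    { toFun := fun f => ⟨fun n => S n ⟨f.1 n, f.2.choose n⟩, f.2.choose_spec⟩
      map_add' := by
        intro f g
        ext n
        exact (S n).map_add ⟨f.1 n, f.2.choose n⟩ ⟨g.1 n, g.2.choose n⟩
      map_smul' := by
        intro c f
        ext n
        exact (S n).map_smul c ⟨f.1 n, f.2.choose n⟩ }

variable {E : Type*} [NormedAddCommGroup E] [InnerProductSpace ℂ E]

/-- `B ≥ 0`: the quadratic form of the operator `B` is non-negative on its domain. -/
def IsNonneg (B : E →ₗ.[ℂ] E) : Prop :=
  ∀ u : B.domain, 0 ≤ (⟪B u, (u : E)⟫_ℂ).re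

/-- The bounded everywhere defined operator `R` is the inverse `(B + x)⁻¹`. -/
def IsShiftInverse (B : E →ₗ.[ℂ] E) (x : ℝ) (R : E →L[ℂ] E) : Prop :=
  (∀ f : E, ∃ h : R f ∈ B.domain, B ⟨R f, h⟩ + (x : ℂ) • R f = f) ∧
    ∀ u : B.domain, R (B u + (x : ℂ) • (u : E)) = u

/-- `(B + x)⁻¹ ≤ (C + x)⁻¹` for all `x > 0`: the inverses exist as bounded everywhere defined
operators, and they are compared in the Loewner order (`T ≤ T'` iff `T' - T` is a positive
operator). -/
def ResolventLE (B C : E →ₗ.[ℂ] E) : Prop :=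
  ∀ x : ℝ, 0 < x → ∃ R R' : E →L[ℂ] E,
    IsShiftInverse B x R ∧ IsShiftInverse C x R' ∧ R ≤ R'

/-- `B` is a non-negative self-adjoint extension of `A`, i.e. `B ∈ Ext_A(0, ∞)`. -/
structure IsNonnegSAExtension [CompleteSpace E] (A B : E →ₗ.[ℂ] E) : Prop where
  extends_op : A ≤ B
  selfAdjoint : IsSelfAdjoint B
  nonneg : IsNonneg B

/-- `F` is the Friedrichs extension of `A`: the biggest non-negative self-adjoint extension, that
is, the one with `(F + x)⁻¹ ≤ (B + x)⁻¹` for all `x > 0` and all non-negative self-adjoint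
extensions `B` of `A`. -/
structure IsFriedrichsExtension [CompleteSpace E] (A F : E →ₗ.[ℂ] E) : Prop where
  isExtension : IsNonnegSAExtension A F
  extremal : ∀ B : E →ₗ.[ℂ] E, IsNonnegSAExtension A B → ResolventLE F B

/-- `K` is the Krein extension of `A`: the smallest non-negative self-adjoint extension, that
is, the one with `(B + x)⁻¹ ≤ (K + x)⁻¹` for all `x > 0` and all non-negative self-adjoint
extensions `B` of `A`. -/
structure IsKreinExtension [CompleteSpace E] (A K : E →ₗ.[ℂ] E) : Prop where
  isExtension : IsNonnegSAExtension A K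
  extremal : ∀ B : E →ₗ.[ℂ] E, IsNonnegSAExtension A B → ResolventLE B K

end

end NonnegExt

/-! Both extremal extensions come from one problem: find the least positive bounded `P` with `P (g
v) = h v`. If `⟪g v, h w⟫` is a positive semidefinite form that controls `‖h v‖²`, then `P` exists,
and its form at `f` is the supremum over `v` of `2 Re ⟪f, h v⟫ - Re ⟪g v, h v⟫`. Take `g = A + 1`.
With `h` the inclusion of `dom A`, `P` is the Friedrichs resolvent at `-1`. With `h = A`, `1 - P` is
the Krein resolvent at `-1`, because `R ↦ 1 - R` reverses order and `1 - R` sends `(A + 1) u` to `A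
u`. Inequalities at `x = 1` pass to all `x > 0` by operator antitonicity of inversion
(`resolventLE_of_le`).

For the direct sum, no competing extension needs to be block diagonal. A positive `X` that solves
the equations on each summand solves them on finite sums, so its form dominates every partial sum of
the forms of the `P n` (`diagonal_le`). The diagonal of least solutions is therefore least.
Uniqueness is antisymmetry of the order. -/

namespace NonnegExt

/-! ### Least positive solutions of operator equations. -/

section Bounded

variable {E : Type*} [NormedAddCommGroup E] [InnerProductSpace ℂ E]

/-- `P` is the least positive bounded operator with `P (g v) = h v` for all `v`: it is a positive
solution, and its quadratic form is the supremum of `2 Re ⟪f, h v⟫ - Re ⟪g v, h v⟫`, a lower bound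
for every positive solution. -/
structure IsLeastSolution {V : Type*} [AddCommGroup V] [Module ℂ V] (g h : V →ₗ[ℂ] E)
    (P : E →L[ℂ] E) : Prop where
  nonneg : 0 ≤ P
  map_eq : ∀ v, P (g v) = h v
  approx : ∀ f, ∀ ε : ℝ, 0 < ε → ∃ v,
    (⟪P f, f⟫_ℂ).re - ε < 2 * (⟪f, h v⟫_ℂ).re - (⟪g v, h v⟫_ℂ).re

/-- A positive bounded operator mapping `a` to `b` has quadratic form at least
`2 Re ⟪f, b⟫ - Re ⟪a, b⟫`. -/
theorem le_re_inner_of_map_eq {X : E →L[ℂ] E} (hX : 0 ≤ X) {a b : E} (hab : X a = b) (f : E) :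
    2 * (⟪f, b⟫_ℂ).re - (⟪a, b⟫_ℂ).re ≤ (⟪X f, f⟫_ℂ).re := by
  rw [ContinuousLinearMap.nonneg_iff_isPositive] at hX
  -- The bound is the expansion of this inequality.
  have h1 : 0 ≤ (⟪X (f - a), f - a⟫_ℂ).re := hX.re_inner_nonneg_left _
  have h2 : ⟪X f, a⟫_ℂ = ⟪f, b⟫_ℂ := by rw [hX.inner_left_eq_inner_right, hab]
  have h3 : (⟪b, f⟫_ℂ).re = (⟪f, b⟫_ℂ).re := inner_re_symm (𝕜 := ℂ) b f
  have h4 : (⟪b, a⟫_ℂ).re = (⟪a, b⟫_ℂ).re := inner_re_symm (𝕜 := ℂ) b a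
  simp only [map_sub, inner_sub_left, inner_sub_right, hab, h2, Complex.sub_re, h3, h4] at h1
  linarith

theorem isPositive_iff_re {X : E →L[ℂ] E} :
    X.IsPositive ↔ (X : E →ₗ[ℂ] E).IsSymmetric ∧ ∀ f, 0 ≤ (⟪X f, f⟫_ℂ).re := Iff.rfl

theorem IsLeastSolution.le {V : Type*} [AddCommGroup V] [Module ℂ V] {g h : V →ₗ[ℂ] E}
    {P : E →L[ℂ] E} (hP : IsLeastSolution g h P) {X : E →L[ℂ] E} (hX : 0 ≤ X)
    (hXg : ∀ v, X (g v) = h v) : P ≤ X := by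
  have hP' := hP.nonneg
  rw [ContinuousLinearMap.le_def, isPositive_iff_re]
  have hX' := hX
  rw [ContinuousLinearMap.nonneg_iff_isPositive] at hX' hP'
  refine ⟨?_, fun f => ?_⟩
  · rw [ContinuousLinearMap.toLinearMap_sub]
    exact hX'.isSymmetric.sub hP'.isSymmetric
  · rw [sub_apply, inner_sub_left, Complex.sub_re, sub_nonneg]
    refine le_of_forall_pos_le_add fun ε hε => ?_
    obtain ⟨v, hv⟩ := hP.approx f ε hε
    have := le_re_inner_of_map_eq hX (hXg v) f
    linarith

variable [CompleteSpace E]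

/-- Let `J` extend `h` to the completion of `V`. The hypothesis `hgh` says that `J.adjoint` sends `g
v` to the class of `v`, so `J ∘L J.adjoint` solves the equations. Its form is `‖J.adjoint f‖ ^ 2`,
and density of `V` gives the approximation property. -/
theorem exists_isLeastSolution_of_inner_eq {V : Type*} [SeminormedAddCommGroup V]
    [InnerProductSpace ℂ V] (g : V →ₗ[ℂ] E) (h : V →L[ℂ] E)
    (hgh : ∀ v w, ⟪g v, h w⟫_ℂ = ⟪v, w⟫_ℂ) {C : ℝ} (hC : ∀ v, ‖h v‖ ^ 2 ≤ C * ‖v‖ ^ 2) :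
    ∃ P : E →L[ℂ] E, IsLeastSolution g h P ∧ ∀ f, ‖P f‖ ^ 2 ≤ C * (⟪P f, f⟫_ℂ).re := by
  let W := UniformSpace.Completion V
  let ι : V →L[ℂ] W := UniformSpace.Completion.toComplL
  have hι : DenseRange ι := UniformSpace.Completion.denseRange_coe
  have hιu : IsUniformInducing ι := UniformSpace.Completion.isUniformInducing_coe V
  have hιi : ∀ v w, ⟪ι v, ι w⟫_ℂ = ⟪v, w⟫_ℂ := UniformSpace.Completion.inner_coe
  let J : W →L[ℂ] E := h.extend ι
  have hJ : ∀ v, J (ι v) = h v := fun v => ContinuousLinearMap.extend_eq h hι hιu v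
  have hJC : ∀ w, ‖J w‖ ^ 2 ≤ C * ‖w‖ ^ 2 := fun w =>
    hι.induction_on w (isClosed_le (by fun_prop) (by fun_prop)) fun v => by
      rw [hJ]
      have : ‖ι v‖ = ‖v‖ := UniformSpace.Completion.norm_coe v
      rw [this]; exact hC v
  have hJg : ∀ v, J.adjoint (g v) = ι v := fun v => by
    refine ext_inner_right ℂ fun w => ?_
    refine hι.induction_on w (isClosed_eq (by fun_prop) (by fun_prop)) fun u => ?_
    rw [ContinuousLinearMap.adjoint_inner_left, hJ, hgh, hιi]
  have hform : ∀ f, (⟪(J ∘L J.adjoint) f, f⟫_ℂ).re = ‖J.adjoint f‖ ^ 2 := fun f => by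
    rw [ContinuousLinearMap.comp_apply, ← ContinuousLinearMap.adjoint_inner_right]
    exact inner_self_eq_norm_sq (𝕜 := ℂ) _
  refine ⟨J ∘L J.adjoint, ⟨?_, fun v => ?_, fun f ε hε => ?_⟩, fun f => ?_⟩
  · rw [ContinuousLinearMap.nonneg_iff_isPositive]
    exact ContinuousLinearMap.isPositive_self_comp_adjoint J
  · rw [ContinuousLinearMap.comp_apply, hJg, hJ]; rfl
  -- Expanding `‖J.adjoint f - ι v‖ ^ 2 < ε` gives the required inequality.
  · obtain ⟨v, hv⟩ := hι.exists_dist_lt (J.adjoint f) (Real.sqrt_pos.2 hε)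
    refine ⟨v, ?_⟩
    rw [hform]
    rw [dist_eq_norm] at hv
    have h1 : ‖J.adjoint f - ι v‖ ^ 2 < ε := by
      have := (Real.lt_sqrt (norm_nonneg _)).1 hv
      exact this
    rw [@norm_sub_sq ℂ] at h1
    have h2 : ⟪J.adjoint f, ι v⟫_ℂ = ⟪f, h v⟫_ℂ := by
      rw [ContinuousLinearMap.adjoint_inner_left, hJ]
    have h3 : ‖ι v‖ ^ 2 = (⟪g v, h v⟫_ℂ).re := by
      rw [hgh, ← hιi]
      exact (inner_self_eq_norm_sq (𝕜 := ℂ) _).symm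
    rw [h2, h3] at h1
    change _ < 2 * (⟪f, h v⟫_ℂ).re - (⟪g v, h v⟫_ℂ).re
    change ‖J.adjoint f‖ ^ 2 - 2 * (⟪f, h v⟫_ℂ).re + (⟪g v, h v⟫_ℂ).re < ε at h1
    linarith
  · rw [hform]; exact hJC _

/-- The form `⟪g v, h w⟫` serves as a possibly degenerate inner product on `V`; `hC` yields both its
positivity and the continuity of `h`. -/
theorem exists_isLeastSolution {V : Type*} [AddCommGroup V] [Module ℂ V] (g h : V →ₗ[ℂ] E)
    (hsymm : ∀ v w, ⟪g v, h w⟫_ℂ = ⟪h v, g w⟫_ℂ) {C : ℝ} (hC₀ : 0 < C)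
    (hC : ∀ v, ‖h v‖ ^ 2 ≤ C * (⟪g v, h v⟫_ℂ).re) :
    ∃ P : E →L[ℂ] E, IsLeastSolution g h P ∧ ∀ f, ‖P f‖ ^ 2 ≤ C * (⟪P f, f⟫_ℂ).re := by
  let c : PreInnerProductSpace.Core ℂ V :=
    { inner := fun v w => ⟪g v, h w⟫_ℂ
      conj_inner_symm := fun v w => by rw [inner_conj_symm, hsymm]
      re_inner_nonneg := fun v => by
        have := (sq_nonneg ‖h v‖).trans (hC v)
        exact nonneg_of_mul_nonneg_right this hC₀
      add_left := fun u v w => by rw [map_add, inner_add_left]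
      smul_left := fun v w a => by rw [map_smul, inner_smul_left] }
  let : SeminormedAddCommGroup V := InnerProductSpace.Core.toSeminormedAddCommGroup (c := c)
  let : InnerProductSpace ℂ V := InnerProductSpace.ofCore c
  have hn : ∀ v : V, ‖v‖ ^ 2 = (⟪g v, h v⟫_ℂ).re := fun v =>
    (inner_self_eq_norm_sq (𝕜 := ℂ) v).symm
  have hC' : ∀ v, ‖h v‖ ^ 2 ≤ C * ‖v‖ ^ 2 := fun v => by rw [hn]; exact hC v
  have hb : ∀ v, ‖h v‖ ≤ √C * ‖v‖ := fun v => by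
    rw [← Real.sqrt_sq (norm_nonneg v), ← Real.sqrt_mul hC₀.le]
    exact Real.le_sqrt_of_sq_le (hC' v)
  exact exists_isLeastSolution_of_inner_eq g (h.mkContinuous (√C) hb) (fun _ _ => rfl) hC'

end Bounded

/-! ### Resolvents of non-negative self-adjoint operators. -/

section Resolvent

variable {E : Type*} [NormedAddCommGroup E] [InnerProductSpace ℂ E]

/-- The operator `B + x` on the domain of `B`. -/
noncomputable def shiftMap (B : E →ₗ.[ℂ] E) (x : ℝ) : B.domain →ₗ[ℂ] E :=
  B.toFun + (x : ℂ) • B.domain.subtype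

theorem shiftMap_apply (B : E →ₗ.[ℂ] E) (x : ℝ) (u : B.domain) :
    shiftMap B x u = B u + (x : ℂ) • (u : E) := rfl

theorem inner_shiftMap_re (B : E →ₗ.[ℂ] E) (x : ℝ) (u : B.domain) :
    (⟪shiftMap B x u, (u : E)⟫_ℂ).re = (⟪B u, (u : E)⟫_ℂ).re + x * ‖(u : E)‖ ^ 2 := by
  rw [shiftMap_apply, inner_add_left, inner_smul_left, Complex.add_re, Complex.conj_ofReal,
    Complex.re_ofReal_mul]
  congr 2
  exact inner_self_eq_norm_sq (𝕜 := ℂ) _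

theorem IsShiftInverse.apply_shiftMap {B : E →ₗ.[ℂ] E} {x : ℝ} {R : E →L[ℂ] E}
    (hR : IsShiftInverse B x R) (u : B.domain) : R (shiftMap B x u) = u := hR.2 u

theorem IsShiftInverse.unique {B : E →ₗ.[ℂ] E} {x : ℝ} {R R' : E →L[ℂ] E}
    (hR : IsShiftInverse B x R) (hR' : IsShiftInverse B x R') : R = R' := by
  ext f
  obtain ⟨h, hf⟩ := hR.1 f
  have := hR'.2 ⟨R f, h⟩
  rw [hf] at this
  exact this.symm

theorem IsShiftInverse.le {B C : E →ₗ.[ℂ] E} {x : ℝ} {R : E →L[ℂ] E}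
    (hB : IsShiftInverse B x R) (hC : IsShiftInverse C x R) : B ≤ C := by
  have key : ∀ u : B.domain, ∃ h : (u : E) ∈ C.domain, C ⟨u, h⟩ = B u := fun u => by
    obtain ⟨h, hf⟩ := hC.1 (B u + (x : ℂ) • (u : E))
    simp only [hB.2 u] at h hf
    exact ⟨h, add_right_cancel hf⟩
  refine ⟨fun u hu => (key ⟨u, hu⟩).1, fun u v huv => ?_⟩
  obtain ⟨h, hu⟩ := key u
  rw [← hu]
  congr 1
  exact Subtype.ext huv

theorem IsShiftInverse.eq {B C : E →ₗ.[ℂ] E} {x : ℝ} {R : E →L[ℂ] E}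
    (hB : IsShiftInverse B x R) (hC : IsShiftInverse C x R) : B = C :=
  le_antisymm (hB.le hC) (hC.le hB)

theorem IsShiftInverse.apply_of_le {A B : E →ₗ.[ℂ] E} {x : ℝ} {R : E →L[ℂ] E}
    (hR : IsShiftInverse B x R) (hAB : A ≤ B) (u : A.domain) : R (shiftMap A x u) = u := by
  have h : A u = B ⟨u, hAB.1 u.2⟩ := hAB.2 rfl
  rw [shiftMap_apply, h]
  exact hR.2 ⟨u, hAB.1 u.2⟩

/-- The first resolvent identity. -/
theorem IsShiftInverse.resolvent_identity {B : E →ₗ.[ℂ] E} {x y : ℝ} {R S : E →L[ℂ] E}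
    (hR : IsShiftInverse B x R) (hS : IsShiftInverse B y S) :
    S = R + ((x - y : ℝ) : ℂ) • (R * S) := by
  ext f
  obtain ⟨h, hf⟩ := hS.1 f
  have h2 := hR.2 ⟨S f, h⟩
  have h3 : B ⟨S f, h⟩ + (x : ℂ) • S f = f + ((x - y : ℝ) : ℂ) • S f := by
    rw [eq_sub_of_add_eq hf]
    push_cast
    module
  simp only [h3, map_add, map_smul] at h2
  simpa using h2.symm

variable [CompleteSpace E]

theorem exists_apply_eq_of_isSelfAdjoint {B : E →ₗ.[ℂ] E} (hB : IsSelfAdjoint B) {y w : E}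
    (hyw : ∀ u : B.domain, ⟪w, (u : E)⟫_ℂ = ⟪y, B u⟫_ℂ) :
    ∃ h : y ∈ B.domain, B ⟨y, h⟩ = w := by
  have hd := hB.dense_domain
  have h1 : y ∈ B.adjoint.domain := LinearPMap.mem_adjoint_domain_of_exists y ⟨w, hyw⟩
  have h2 : B.adjoint ⟨y, h1⟩ = w := LinearPMap.adjoint_apply_eq hd _ hyw
  have h3 : B.adjoint = B := hB
  have h4 : B.adjoint ≤ B := h3.le
  exact ⟨h4.1 h1, (h4.2 (x := ⟨y, h1⟩) (y := ⟨y, h4.1 h1⟩) rfl).symm.trans h2⟩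

theorem isFormalAdjoint_of_isSelfAdjoint {B : E →ₗ.[ℂ] E} (hB : IsSelfAdjoint B) :
    B.IsFormalAdjoint B := by
  have h := LinearPMap.adjoint_isFormalAdjoint hB.dense_domain
  have h3 : B.adjoint = B := hB
  rwa [h3] at h

omit [CompleteSpace E] in
theorem inner_shiftMap_symm {B : E →ₗ.[ℂ] E} (hB : B.IsFormalAdjoint B) (x : ℝ) (u v : B.domain) :
    ⟪shiftMap B x u, (v : E)⟫_ℂ = ⟪(u : E), shiftMap B x v⟫_ℂ := by
  rw [shiftMap_apply, shiftMap_apply, inner_add_left, inner_add_right, inner_smul_left,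
    inner_smul_right, Complex.conj_ofReal, hB u v]

/-- A non-negative self-adjoint operator has a resolvent at every `-x < 0`. -/
theorem exists_isShiftInverse {B : E →ₗ.[ℂ] E} (hB : IsSelfAdjoint B) (hB0 : IsNonneg B) {x : ℝ}
    (hx : 0 < x) :
    ∃ R : E →L[ℂ] E, IsShiftInverse B x R ∧ 0 ≤ R ∧ ∀ f, x * ‖R f‖ ^ 2 ≤ (⟪R f, f⟫_ℂ).re := by
  have hsymm := isFormalAdjoint_of_isSelfAdjoint hB
  obtain ⟨R, hR, hRx⟩ := exists_isLeastSolution (shiftMap B x) B.domain.subtype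
    (fun u v => inner_shiftMap_symm hsymm x u v) (inv_pos.2 hx) (fun u => by
      have := hB0 u
      rw [Submodule.subtype_apply, inner_shiftMap_re, ← div_eq_inv_mul, le_div_iff₀ hx]
      linarith)
  have hpos := hR.nonneg
  rw [ContinuousLinearMap.nonneg_iff_isPositive] at hpos
  refine ⟨R, ⟨fun f => ?_, fun u => hR.map_eq u⟩, hR.nonneg, fun f => ?_⟩
  -- Since `⟪R f, (B + x) u⟫ = ⟪f, u⟫`, the vector `R f` lies in the domain of the adjoint of `B`,
  -- which is `B`.
  · obtain ⟨h, hf⟩ := exists_apply_eq_of_isSelfAdjoint hB (y := R f) (w := f - (x : ℂ) • R f)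
      fun u => by
        have h1 : ⟪R f, shiftMap B x u⟫_ℂ = ⟪f, (u : E)⟫_ℂ := by
          rw [hpos.inner_left_eq_inner_right, hR.map_eq]; rfl
        rw [shiftMap_apply, inner_add_right, inner_smul_right] at h1
        rw [inner_sub_left, inner_smul_left, Complex.conj_ofReal, ← h1]
        ring
    exact ⟨h, by rw [hf]; abel⟩
  · have := hRx f
    rwa [← div_eq_inv_mul, le_div_iff₀ hx, mul_comm] at this

/-- The domain of `B` is the range of the symmetric injective `R`, hence dense, and symmetry passes
from `R` to `B`. Any `y` in the adjoint domain equals `R` applied to `B.adjoint y + x y`, so it lies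
in the domain of `B`. -/
theorem IsShiftInverse.isSelfAdjoint {B : E →ₗ.[ℂ] E} {x : ℝ} {R : E →L[ℂ] E}
    (hR : IsShiftInverse B x R) (hpos : R.IsPositive) : IsSelfAdjoint B := by
  have hdense : Dense (B.domain : Set E) := by
    rw [Submodule.dense_iff_topologicalClosure_eq_top, Submodule.topologicalClosure_eq_top_iff,
      Submodule.eq_bot_iff]
    intro w hw
    have hRw : R w = 0 := by
      refine ext_inner_right ℂ fun f => ?_
      rw [hpos.inner_left_eq_inner_right, inner_zero_left]
      exact (Submodule.mem_orthogonal' _ _).1 hw _ (hR.1 f).1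
    obtain ⟨h, hf⟩ := hR.1 w
    have h0 : (⟨R w, h⟩ : B.domain) = 0 := Subtype.ext hRw
    rw [h0, hRw, LinearPMap.map_zero, smul_zero, add_zero] at hf
    exact hf.symm
  have hsymm : B.IsFormalAdjoint B := fun u v => by
    have h1 : ⟪shiftMap B x u, (v : E)⟫_ℂ = ⟪(u : E), shiftMap B x v⟫_ℂ := by
      rw [← hR.apply_shiftMap u, ← hR.apply_shiftMap v, hpos.inner_left_eq_inner_right,
        hR.apply_shiftMap]
    rw [shiftMap_apply, shiftMap_apply, inner_add_left, inner_add_right, inner_smul_left,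
      inner_smul_right, Complex.conj_ofReal] at h1
    exact add_right_cancel h1
  have hle : B ≤ B.adjoint := hsymm.le_adjoint hdense
  refine (LinearPMap.eq_of_le_of_domain_eq hle (le_antisymm hle.1 fun y hy => ?_)).symm
  obtain ⟨h, hf⟩ := hR.1 (B.adjoint ⟨y, hy⟩ + (x : ℂ) • y)
  have hadj := LinearPMap.adjoint_isFormalAdjoint hdense
  suffices y = R (B.adjoint ⟨y, hy⟩ + (x : ℂ) • y) by rw [this]; exact h
  refine ext_inner_right ℂ fun f => ?_
  obtain ⟨h', hf'⟩ := hR.1 f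
  rw [hpos.inner_left_eq_inner_right]
  conv_lhs => rw [← hf']
  rw [inner_add_left, inner_add_right, inner_smul_left, inner_smul_right, Complex.conj_ofReal,
    ← hadj ⟨y, hy⟩ ⟨R f, h'⟩]

/-- A bounded operator `R` with `0 ≤ R ≤ 1` (in the form `‖R f‖² ≤ ⟪R f, f⟫`) which extends the
resolvent of a densely defined operator `A` at `-1` is the resolvent of a non-negative self-adjoint
extension of `A`. -/
theorem exists_isNonnegSAExtension {A : E →ₗ.[ℂ] E} (hA : Dense (A.domain : Set E))
    {R : E →L[ℂ] E} (hpos : R.IsPositive) (hR : ∀ f, ‖R f‖ ^ 2 ≤ (⟪R f, f⟫_ℂ).re)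
    (hRA : ∀ u : A.domain, R (shiftMap A 1 u) = u) :
    ∃ B, IsNonnegSAExtension A B ∧ IsShiftInverse B 1 R := by
  -- The kernel of `R` is orthogonal to its range, which contains the dense subspace `A.domain`.
  have hinj : Function.Injective (R : E →ₗ[ℂ] E) := by
    rw [← LinearMap.ker_eq_bot, LinearMap.ker_eq_bot']
    intro f hf
    refine hA.eq_zero_of_inner_left ℂ fun u hu => ?_
    have h1 : R (shiftMap A 1 ⟨u, hu⟩) = u := hRA ⟨u, hu⟩
    have h2 : R f = 0 := hf
    rw [← h1, ← hpos.inner_left_eq_inner_right, h2, inner_zero_left]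
  let e := LinearEquiv.ofInjective (R : E →ₗ[ℂ] E) hinj
  -- This is `R⁻¹ - 1` on the range of `R`.
  let B : E →ₗ.[ℂ] E :=
    ⟨LinearMap.range (R : E →ₗ[ℂ] E), (e.symm : _ →ₗ[ℂ] E) - Submodule.subtype _⟩
  have hBmem : ∀ f, R f ∈ B.domain := fun f => LinearMap.mem_range_self (R : E →ₗ[ℂ] E) f
  have hBR : ∀ f, B ⟨R f, hBmem f⟩ = f - R f := fun f => by
    change e.symm ⟨R f, hBmem f⟩ - R f = f - R f
    congr 1
    exact e.symm_apply_apply f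
  have hBinv : IsShiftInverse B 1 R := by
    refine ⟨fun f => ⟨hBmem f, ?_⟩, ?_⟩
    · rw [hBR, Complex.ofReal_one, one_smul, sub_add_cancel]
    · rintro ⟨_, f, rfl⟩
      have := hBR f
      change R (B ⟨R f, hBmem f⟩ + ((1 : ℝ) : ℂ) • R f) = R f
      rw [hBR, Complex.ofReal_one, one_smul, sub_add_cancel]
  refine ⟨B, ⟨⟨fun u hu => ?_, fun u v huv => ?_⟩, hBinv.isSelfAdjoint hpos, ?_⟩, hBinv⟩
  · have h1 := hBmem (shiftMap A 1 ⟨u, hu⟩)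
    rwa [hRA] at h1
  · have h1 : v = ⟨R (shiftMap A 1 u), hBmem _⟩ := Subtype.ext (huv.symm.trans (hRA u).symm)
    rw [h1, hBR, hRA, shiftMap_apply, Complex.ofReal_one, one_smul, add_sub_cancel_right]
  · rintro ⟨_, f, rfl⟩
    change 0 ≤ (⟪B ⟨R f, hBmem f⟩, R f⟫_ℂ).re
    rw [hBR, inner_sub_left, Complex.sub_re]
    have h1 : (⟪R f, R f⟫_ℂ).re = ‖R f‖ ^ 2 := inner_self_eq_norm_sq (𝕜 := ℂ) _
    have h2 : (⟪f, R f⟫_ℂ).re = (⟪R f, f⟫_ℂ).re := inner_re_symm (𝕜 := ℂ) _ _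
    rw [h1, h2]
    linarith [hR f]

omit [CompleteSpace E] in
/-- The positive unit `1 - (1 - x) (B + 1)⁻¹`, whose inverse is `1 + (1 - x) (B + x)⁻¹`. -/
theorem exists_unit_of_isShiftInverse {B : E →ₗ.[ℂ] E} {x : ℝ} (hx : 0 < x) {R S : E →L[ℂ] E}
    (hR : IsShiftInverse B 1 R) (hS : IsShiftInverse B x S) (hpos : R.IsPositive)
    (hR1 : ∀ f, ‖R f‖ ^ 2 ≤ (⟪R f, f⟫_ℂ).re) :
    ∃ a : (E →L[ℂ] E)ˣ, (a : E →L[ℂ] E) = 1 - ((1 - x : ℝ) : ℂ) • R ∧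
      (↑a⁻¹ : E →L[ℂ] E) = 1 + ((1 - x : ℝ) : ℂ) • S ∧ 0 ≤ (a : E →L[ℂ] E) := by
  have e1 := hR.resolvent_identity hS
  have e2 := hS.resolvent_identity hR
  have hc : ((x - 1 : ℝ) : ℂ) = -((1 - x : ℝ) : ℂ) := by push_cast; ring
  rw [hc] at e2
  set c := ((1 - x : ℝ) : ℂ) with hcdef
  refine ⟨⟨1 - c • R, 1 + c • S, ?_, ?_⟩, rfl, rfl, ?_⟩
  · have : (1 - c • R) * (1 + c • S) = 1 + c • (S - (R + c • (R * S))) := by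
      simp only [sub_mul, mul_add, one_mul, mul_one, smul_mul_smul_comm, smul_sub, smul_add,
        smul_smul]
      abel
    rw [this, ← e1, sub_self, smul_zero, add_zero]
  · have : (1 + c • S) * (1 - c • R) = 1 + c • ((S + -c • (S * R)) - R) := by
      simp only [add_mul, mul_sub, one_mul, mul_one, smul_mul_smul_comm, smul_sub, smul_add,
        smul_smul, neg_smul, smul_neg]
      abel
    rw [this, ← e2, sub_self, smul_zero, add_zero]
  · change 0 ≤ 1 - c • R
    rw [ContinuousLinearMap.nonneg_iff_isPositive, isPositive_iff_re]
    refine ⟨fun f g => ?_, fun f => ?_⟩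
    · change ⟪f - c • R f, g⟫_ℂ = ⟪f, g - c • R g⟫_ℂ
      rw [inner_sub_left, inner_sub_right, inner_smul_left, inner_smul_right,
        hpos.inner_left_eq_inner_right, hcdef, Complex.conj_ofReal]
    · change 0 ≤ (⟪f - c • R f, f⟫_ℂ).re
      rw [inner_sub_left, inner_smul_left, hcdef, Complex.conj_ofReal, Complex.sub_re,
        Complex.re_ofReal_mul]
      have h1 : (⟪f, f⟫_ℂ).re = ‖f‖ ^ 2 := inner_self_eq_norm_sq (𝕜 := ℂ) _
      have h2 : (⟪R f, f⟫_ℂ).re ≤ ‖R f‖ * ‖f‖ := re_inner_le_norm (𝕜 := ℂ) _ _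
      have h3 : 0 ≤ (⟪R f, f⟫_ℂ).re := hpos.re_inner_nonneg_left f
      have h4 := hR1 f
      have h5 : (⟪R f, f⟫_ℂ).re ≤ ‖f‖ ^ 2 := by
        nlinarith [sq_nonneg (‖R f‖ - ‖f‖)]
      rw [h1]
      -- The quantity is `(‖f‖² - ⟪R f, f⟫) + x ⟪R f, f⟫`, with both terms non-negative.
      nlinarith

/-- The order of the resolvents at `-1` determines the order of the resolvents at all `-x < 0`. -/
theorem resolventLE_of_le {B C : E →ₗ.[ℂ] E} (hB : IsSelfAdjoint B) (hB0 : IsNonneg B)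
    (hC : IsSelfAdjoint C) (hC0 : IsNonneg C) {R R' : E →L[ℂ] E} (hR : IsShiftInverse B 1 R)
    (hR' : IsShiftInverse C 1 R') (hle : R ≤ R') : ResolventLE B C := by
  intro x hx
  obtain ⟨S, hS, -, -⟩ := exists_isShiftInverse hB hB0 hx
  obtain ⟨S', hS', -, -⟩ := exists_isShiftInverse hC hC0 hx
  refine ⟨S, S', hS, hS', ?_⟩
  obtain ⟨R₁, h1, hpos, hR1⟩ := exists_isShiftInverse hB hB0 one_pos
  obtain ⟨R₁', h1', hpos', hR1'⟩ := exists_isShiftInverse hC hC0 one_pos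
  obtain rfl := h1.unique hR
  obtain rfl := h1'.unique hR'
  simp only [one_mul] at hR1 hR1'
  rw [ContinuousLinearMap.nonneg_iff_isPositive] at hpos hpos'
  obtain ⟨a, ha, hai, ha0⟩ := exists_unit_of_isShiftInverse hx hR hS hpos hR1
  obtain ⟨b, hb, hbi, hb0⟩ := exists_unit_of_isShiftInverse hx hR' hS' hpos' hR1'
  have hsmul : ∀ {c : ℝ} {X Y : E →L[ℂ] E}, 0 ≤ c → X ≤ Y → (c : ℂ) • X ≤ (c : ℂ) • Y := by
    intro c X Y hc hXY
    rw [ContinuousLinearMap.le_def] at hXY ⊢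
    rw [← smul_sub]
    exact hXY.smul_of_nonneg (Complex.zero_le_real.2 hc)
  have hcancel : ∀ {c : ℝ} {X Y : E →L[ℂ] E}, 0 < c → (c : ℂ) • X ≤ (c : ℂ) • Y → X ≤ Y := by
    intro c X Y hc hXY
    have := hsmul (inv_nonneg.2 hc.le) hXY
    rwa [smul_smul, smul_smul, ← Complex.ofReal_mul, inv_mul_cancel₀ hc.ne', Complex.ofReal_one,
      one_smul, one_smul] at this
  rcases lt_trichotomy x 1 with hx1 | rfl | hx1
  -- Inversion reverses `b ≤ a`, and the inverses are `1 + (1 - x) S` and `1 + (1 - x) S'`. For `x >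
  -- 1` the sign of `1 - x` flips both comparisons.
  · have hab : (b : E →L[ℂ] E) ≤ a := by
      rw [ha, hb]
      exact sub_le_sub_left (hsmul (by linarith) hle) 1
    have := CStarAlgebra.inv_le_inv hb0 hab
    rw [hai, hbi] at this
    exact hcancel (sub_pos.2 hx1) (le_of_add_le_add_left this)
  · rwa [hS.unique hR, hS'.unique hR']
  · have hneg : ((1 - x : ℝ) : ℂ) = -((x - 1 : ℝ) : ℂ) := by push_cast; ring
    rw [hneg, neg_smul] at ha hb hai hbi
    have hab : (a : E →L[ℂ] E) ≤ b := by
      rw [ha, hb, sub_neg_eq_add, sub_neg_eq_add]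
      exact add_le_add_right (hsmul (by linarith) hle) 1
    have := CStarAlgebra.inv_le_inv ha0 hab
    rw [hai, hbi] at this
    exact hcancel (sub_pos.2 hx1) (neg_le_neg_iff.1 (le_of_add_le_add_left this))

end Resolvent

/-! ### Existence and uniqueness of the Friedrichs and Krein extensions. -/

section Extremal

variable {E : Type*} [NormedAddCommGroup E] [InnerProductSpace ℂ E] [CompleteSpace E]

omit [CompleteSpace E] in
theorem ResolventLE.antisymm {B C : E →ₗ.[ℂ] E} (h : ResolventLE B C) (h' : ResolventLE C B) :
    B = C := by
  obtain ⟨R, R', hR, hR', hle⟩ := h 1 one_pos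
  obtain ⟨S', S, hS', hS, hle'⟩ := h' 1 one_pos
  obtain rfl := hR.unique hS
  obtain rfl := hR'.unique hS'
  obtain rfl := le_antisymm hle hle'
  exact hR.eq hR'

theorem IsFriedrichsExtension.unique {A F F' : E →ₗ.[ℂ] E} (h : IsFriedrichsExtension A F)
    (h' : IsFriedrichsExtension A F') : F = F' :=
  (h.extremal F' h'.isExtension).antisymm (h'.extremal F h.isExtension)

theorem IsKreinExtension.unique {A K K' : E →ₗ.[ℂ] E} (h : IsKreinExtension A K)
    (h' : IsKreinExtension A K') : K = K' :=
  (h'.extremal K h.isExtension).antisymm (h.extremal K' h'.isExtension)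

/-- The resolvent at `-1` of any competing extension is one of the operators `X` in `hmin`. -/
theorem isFriedrichsExtension_of_forall_le {A F : E →ₗ.[ℂ] E} {R : E →L[ℂ] E}
    (hF : IsNonnegSAExtension A F) (hR : IsShiftInverse F 1 R)
    (hmin : ∀ X : E →L[ℂ] E, 0 ≤ X → (∀ u : A.domain, X (shiftMap A 1 u) = u) → R ≤ X) :
    IsFriedrichsExtension A F := by
  refine ⟨hF, fun B hB => ?_⟩
  obtain ⟨X, hX, hX0, -⟩ := exists_isShiftInverse hB.selfAdjoint hB.nonneg one_pos
  exact resolventLE_of_le hF.selfAdjoint hF.nonneg hB.selfAdjoint hB.nonneg hR hX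
    (hmin X hX0 fun u => hX.apply_of_le hB.extends_op u)

omit [CompleteSpace E] in
/-- The form bound `‖R f‖² ≤ ⟪R f, f⟫` is inherited by `1 - R`. -/
theorem norm_sq_one_sub_apply_le {R : E →L[ℂ] E} (hR : ∀ f, ‖R f‖ ^ 2 ≤ (⟪R f, f⟫_ℂ).re) (f : E) :
    ‖(1 - R) f‖ ^ 2 ≤ (⟪(1 - R) f, f⟫_ℂ).re := by
  change ‖f - R f‖ ^ 2 ≤ (⟪f - R f, f⟫_ℂ).re
  have h1 : (⟪f, f⟫_ℂ).re = ‖f‖ ^ 2 := inner_self_eq_norm_sq (𝕜 := ℂ) _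
  have h2 : (⟪f, R f⟫_ℂ).re = (⟪R f, f⟫_ℂ).re := inner_re_symm (𝕜 := ℂ) _ _
  have h3 : ‖f - R f‖ ^ 2 = ‖f‖ ^ 2 - 2 * (⟪f, R f⟫_ℂ).re + ‖R f‖ ^ 2 := @norm_sub_sq ℂ _ _ _ _ _ _
  rw [h3, inner_sub_left, Complex.sub_re, h1, h2]
  linarith [hR f]

omit [CompleteSpace E] in
theorem isPositive_one_sub {R : E →L[ℂ] E} (hpos : R.IsPositive)
    (hR : ∀ f, ‖R f‖ ^ 2 ≤ (⟪R f, f⟫_ℂ).re) : (1 - R).IsPositive := by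
  rw [isPositive_iff_re]
  refine ⟨fun f g => ?_, fun f => (sq_nonneg _).trans (norm_sq_one_sub_apply_le hR f)⟩
  change ⟪f - R f, g⟫_ℂ = ⟪f, g - R g⟫_ℂ
  rw [inner_sub_left, inner_sub_right, hpos.inner_left_eq_inner_right]

/-- Here `hmin` is applied to `1 - X`, with `X` the resolvent of a competitor: this is positive and
sends `(A + 1) u` to `A u`. -/
theorem isKreinExtension_of_forall_le {A K : E →ₗ.[ℂ] E} {P : E →L[ℂ] E}
    (hK : IsNonnegSAExtension A K) (hP : IsShiftInverse K 1 (1 - P))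
    (hmin : ∀ X : E →L[ℂ] E, 0 ≤ X → (∀ u : A.domain, X (shiftMap A 1 u) = A u) → P ≤ X) :
    IsKreinExtension A K := by
  refine ⟨hK, fun B hB => ?_⟩
  obtain ⟨X, hX, hX0, hX1⟩ := exists_isShiftInverse hB.selfAdjoint hB.nonneg one_pos
  simp only [one_mul] at hX1
  refine resolventLE_of_le hB.selfAdjoint hB.nonneg hK.selfAdjoint hK.nonneg hX hP ?_
  refine le_sub_comm.1 (hmin (1 - X) ?_ fun u => ?_)
  · rw [ContinuousLinearMap.nonneg_iff_isPositive] at hX0 ⊢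
    exact isPositive_one_sub hX0 hX1
  · change shiftMap A 1 u - X (shiftMap A 1 u) = A u
    rw [hX.apply_of_le hB.extends_op, shiftMap_apply, Complex.ofReal_one, one_smul,
      add_sub_cancel_right]

variable {A : E →ₗ.[ℂ] E}

theorem exists_isFriedrichsExtension (hA : Dense (A.domain : Set E)) (hsymm : A.IsFormalAdjoint A)
    (hnonneg : IsNonneg A) :
    ∃ (F : E →ₗ.[ℂ] E) (P : E →L[ℂ] E), IsFriedrichsExtension A F ∧ IsShiftInverse F 1 P ∧
      IsLeastSolution (shiftMap A 1) A.domain.subtype P ∧ ∀ f, ‖P f‖ ^ 2 ≤ (⟪P f, f⟫_ℂ).re := by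
  obtain ⟨P, hP, hP1⟩ := exists_isLeastSolution (shiftMap A 1) A.domain.subtype
    (fun u v => inner_shiftMap_symm hsymm 1 u v) one_pos (fun u => by
      rw [Submodule.subtype_apply, inner_shiftMap_re]
      linarith [hnonneg u])
  simp only [one_mul] at hP1
  obtain ⟨F, hF, hFP⟩ := exists_isNonnegSAExtension hA
    ((ContinuousLinearMap.nonneg_iff_isPositive P).1 hP.nonneg) hP1 hP.map_eq
  exact ⟨F, P, isFriedrichsExtension_of_forall_le hF hFP fun X => hP.le, hFP, hP, hP1⟩

theorem exists_isKreinExtension (hA : Dense (A.domain : Set E)) (hsymm : A.IsFormalAdjoint A)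
    (hnonneg : IsNonneg A) :
    ∃ (K : E →ₗ.[ℂ] E) (P : E →L[ℂ] E), IsKreinExtension A K ∧ IsShiftInverse K 1 (1 - P) ∧
      IsLeastSolution (shiftMap A 1) A.toFun P ∧ ∀ f, ‖P f‖ ^ 2 ≤ (⟪P f, f⟫_ℂ).re := by
  have hone : ∀ u, shiftMap A 1 u = A u + u := fun u => by
    rw [shiftMap_apply, Complex.ofReal_one, one_smul]
  obtain ⟨P, hP, hP1⟩ := exists_isLeastSolution (shiftMap A 1) A.toFun
    (fun u v => by
      change ⟪shiftMap A 1 u, A v⟫_ℂ = ⟪A u, shiftMap A 1 v⟫_ℂ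
      rw [hone, hone, inner_add_left, inner_add_right, hsymm u v]) one_pos
    (fun u => by
      change ‖A u‖ ^ 2 ≤ 1 * (⟪shiftMap A 1 u, A u⟫_ℂ).re
      have h1 : (⟪A u, A u⟫_ℂ).re = ‖A u‖ ^ 2 := inner_self_eq_norm_sq (𝕜 := ℂ) _
      rw [hone, inner_add_left, Complex.add_re, h1, ← hsymm u u]
      linarith [hnonneg u])
  simp only [one_mul] at hP1
  have hpos := (ContinuousLinearMap.nonneg_iff_isPositive P).1 hP.nonneg
  obtain ⟨K, hK, hKP⟩ := exists_isNonnegSAExtension hA (isPositive_one_sub hpos hP1)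
    (norm_sq_one_sub_apply_le hP1) fun u => by
      change shiftMap A 1 u - P (shiftMap A 1 u) = u
      rw [hP.map_eq, hone]
      exact add_sub_cancel_left _ _
  exact ⟨K, P, isKreinExtension_of_forall_le hK hKP fun X => hP.le, hKP, hP, hP1⟩

end Extremal

/-! ### Direct sums and diagonal operators. -/

section DirectSum

variable {H : ℕ → Type*} [∀ n, NormedAddCommGroup (H n)] [∀ n, InnerProductSpace ℂ (H n)]

theorem directSum_mono {S T : ∀ n, H n →ₗ.[ℂ] H n} (hST : ∀ n, S n ≤ T n) :
    directSum S ≤ directSum T := by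
  have hval : ∀ n (a b : H n) (ha : a ∈ (S n).domain) (hb : b ∈ (T n).domain), a = b →
      S n ⟨a, ha⟩ = T n ⟨b, hb⟩ := fun n a b ha hb hab => (hST n).2 hab
  refine ⟨?_, fun f g hfg => ?_⟩
  · rintro f ⟨h, hf⟩
    refine ⟨fun n => (hST n).1 (h n), ?_⟩
    convert hf using 2 with n
    exact (hval n _ _ (h n) ((hST n).1 (h n)) rfl).symm
  · ext n
    exact hval n _ _ (f.2.choose n) (g.2.choose n) (by rw [hfg])

theorem isNonneg_directSum {S : ∀ n, H n →ₗ.[ℂ] H n} (hS : ∀ n, IsNonneg (S n)) :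
    IsNonneg (directSum S) := fun f => by
  have h := Complex.hasSum_re (lp.hasSum_inner (𝕜 := ℂ) (directSum S f) (f : lp H 2))
  exact h.nonneg fun n => hS n ⟨(f : lp H 2) n, f.2.choose n⟩

theorem single_mem_directSum_domain (S : ∀ n, H n →ₗ.[ℂ] H n) (n : ℕ) (u : (S n).domain) :
    ∃ h : lp.single 2 n (u : H n) ∈ (directSum S).domain,
      directSum S ⟨lp.single 2 n (u : H n), h⟩ = lp.single 2 n (S n u) := by
  have hmem : ∀ m, lp.single 2 n (u : H n) m ∈ (S m).domain := fun m => by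
    by_cases hm : m = n
    · subst hm
      rw [lp.single_apply_self]
      exact u.2
    · rw [lp.single_apply_ne _ _ _ hm]
      exact zero_mem _
  have hval : ∀ m, S m ⟨lp.single 2 n (u : H n) m, hmem m⟩ = lp.single 2 n (S n u) m := fun m => by
    by_cases hm : m = n
    · subst hm
      have e : (⟨lp.single 2 m (u : H m) m, hmem m⟩ : (S m).domain) = u :=
        Subtype.ext (lp.single_apply_self 2 m _)
      exact (congrArg (S m) e).trans (lp.single_apply_self 2 m _).symm
    · have e : (⟨lp.single 2 n (u : H n) m, hmem m⟩ : (S m).domain) = 0 :=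
        Subtype.ext (lp.single_apply_ne 2 n _ hm)
      exact ((congrArg (S m) e).trans (S m).map_zero).trans (lp.single_apply_ne 2 n _ hm).symm
  have hmem' : lp.single 2 n (u : H n) ∈ (directSum S).domain := by
    refine ⟨hmem, ?_⟩
    rw [funext hval]
    exact lp.memℓp _
  exact ⟨hmem', lp.ext (funext hval)⟩

theorem shiftMap_directSum_single (S : ∀ n, H n →ₗ.[ℂ] H n) (x : ℝ) (n : ℕ) (u : (S n).domain) :
    ∃ h : lp.single 2 n (u : H n) ∈ (directSum S).domain,
      shiftMap (directSum S) x ⟨lp.single 2 n (u : H n), h⟩ =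
        lp.single 2 n (shiftMap (S n) x u) := by
  obtain ⟨h, hu⟩ := single_mem_directSum_domain S n u
  refine ⟨h, ?_⟩
  rw [shiftMap_apply, shiftMap_apply, hu, lp.single_add, lp.single_smul]

/-- The diagonal operator on the Hilbert sum given by a sequence of contractions. -/
noncomputable def diagonal (P : ∀ n, H n →L[ℂ] H n) (hP : ∀ n f, ‖P n f‖ ≤ ‖f‖) :
    lp H 2 →L[ℂ] lp H 2 :=
  LinearMap.mkContinuous
    { toFun := fun f => ⟨fun n => P n (f n), (lp.memℓp f).mono' fun n => hP n (f n)⟩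
      map_add' := fun f g => lp.ext (funext fun n => (P n).map_add (f n) (g n))
      map_smul' := fun c f => lp.ext (funext fun n => (P n).map_smul c (f n)) } 1
    fun f => by
      rw [one_mul]
      exact lp.norm_mono (by norm_num) fun n => hP n (f n)

theorem diagonal_apply (P : ∀ n, H n →L[ℂ] H n) (hP : ∀ n f, ‖P n f‖ ≤ ‖f‖) (f : lp H 2) (n : ℕ) :
    diagonal P hP f n = P n (f n) := rfl

theorem isPositive_diagonal {P : ∀ n, H n →L[ℂ] H n} (hP : ∀ n f, ‖P n f‖ ≤ ‖f‖)
    (hpos : ∀ n, (P n).IsPositive) : (diagonal P hP).IsPositive := by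
  rw [isPositive_iff_re]
  refine ⟨fun f g => ?_, fun f => ?_⟩
  · refine (lp.hasSum_inner (𝕜 := ℂ) (diagonal P hP f) g).unique ?_
    convert! lp.hasSum_inner (𝕜 := ℂ) f (diagonal P hP g) using 2 with n
    exact (hpos n).inner_left_eq_inner_right _ _
  · exact (Complex.hasSum_re (lp.hasSum_inner (𝕜 := ℂ) (diagonal P hP f) f)).nonneg
      fun n => (hpos n).re_inner_nonneg_left _

theorem isShiftInverse_directSum {B : ∀ n, H n →ₗ.[ℂ] H n} {x : ℝ} {R : ∀ n, H n →L[ℂ] H n}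
    (hB : ∀ n, IsShiftInverse (B n) x (R n)) {Q : lp H 2 →L[ℂ] lp H 2}
    (hQ : ∀ f n, Q f n = R n (f n)) : IsShiftInverse (directSum B) x Q := by
  refine ⟨fun f => ?_, fun u => lp.ext (funext fun n => ?_)⟩
  · have hmem : ∀ n, Q f n ∈ (B n).domain := fun n => by
      rw [hQ]
      exact ((hB n).1 (f n)).1
    -- Square summability of the images under `B n` follows because they are the components of the
    -- vector `f - x Q f`.
    have hval : ∀ n, B n ⟨Q f n, hmem n⟩ = (f - (x : ℂ) • Q f) n := fun n => by
      obtain ⟨h, hf⟩ := (hB n).1 (f n)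
      have h1 : (⟨Q f n, hmem n⟩ : (B n).domain) = ⟨R n (f n), h⟩ := Subtype.ext (hQ f n)
      rw [h1, eq_sub_of_add_eq hf, ← hQ]
      rfl
    have hmem' : Q f ∈ (directSum B).domain := by
      refine ⟨hmem, ?_⟩
      rw [funext hval]
      exact lp.memℓp _
    refine ⟨hmem', ?_⟩
    have : directSum B ⟨Q f, hmem'⟩ = f - (x : ℂ) • Q f := lp.ext (funext hval)
    rw [this, sub_add_cancel]
  · rw [hQ]
    exact (hB n).2 ⟨(u : lp H 2) n, u.2.choose n⟩

/-- The diagonal operator of least solutions is below every positive operator which solves the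
equations on each summand. -/
theorem diagonal_le {V : ℕ → Type*} [∀ n, AddCommGroup (V n)] [∀ n, Module ℂ (V n)]
    {g h : ∀ n, V n →ₗ[ℂ] H n} {P : ∀ n, H n →L[ℂ] H n} (hP : ∀ n f, ‖P n f‖ ≤ ‖f‖)
    (hleast : ∀ n, IsLeastSolution (g n) (h n) (P n)) {X : lp H 2 →L[ℂ] lp H 2} (hX : 0 ≤ X)
    (hXg : ∀ n v, X (lp.single 2 n (g n v)) = lp.single 2 n (h n v)) : diagonal P hP ≤ X := by
  have hpos := isPositive_diagonal hP fun n =>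
    (ContinuousLinearMap.nonneg_iff_isPositive _).1 (hleast n).nonneg
  have hX' := (ContinuousLinearMap.nonneg_iff_isPositive _).1 hX
  rw [ContinuousLinearMap.le_def, isPositive_iff_re]
  refine ⟨?_, fun f => ?_⟩
  · rw [ContinuousLinearMap.toLinearMap_sub]
    exact hX'.isSymmetric.sub hpos.isSymmetric
  rw [sub_apply, inner_sub_left, Complex.sub_re, sub_nonneg]
  have hsum := Complex.hasSum_re (lp.hasSum_inner (𝕜 := ℂ) (diagonal P hP f) f)
  refine hasSum_le_of_sum_le hsum fun s => ?_
  refine le_of_forall_pos_le_add fun ε hε => ?_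
  -- The error `ε` is shared among the indices in `s`; the `+ 1` covers empty `s`.
  have hδ : 0 < ε / (s.card + 1) := by positivity
  choose v hv using fun n => (hleast n).approx (f n) _ hδ
  -- All indices in `s` are tested at once with a finite sum of single-summand vectors; cross terms
  -- vanish by orthogonality of the summands, whatever `X` is.
  have hkey := le_re_inner_of_map_eq hX (a := ∑ n ∈ s, lp.single 2 n (g n (v n)))
    (b := ∑ n ∈ s, lp.single 2 n (h n (v n))) (by simp only [map_sum, hXg]) f
  have h1 : ⟪f, ∑ n ∈ s, lp.single 2 n (h n (v n))⟫_ℂ = ∑ n ∈ s, ⟪f n, h n (v n)⟫_ℂ := by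
    simp only [inner_sum, lp.inner_single_right]
  have h2 : ⟪∑ n ∈ s, lp.single 2 n (g n (v n)), ∑ n ∈ s, lp.single 2 n (h n (v n))⟫_ℂ =
      ∑ n ∈ s, ⟪g n (v n), h n (v n)⟫_ℂ := by
    rw [sum_inner]
    refine Finset.sum_congr rfl fun n hn => ?_
    rw [lp.inner_single_left, lp.coeFn_sum, Finset.sum_apply, Finset.sum_eq_single n]
    · rw [lp.single_apply_self]
    · intro m _ hm
      exact lp.single_apply_ne _ _ _ hm.symm
    · exact fun h => absurd hn h
  rw [h1, h2, Complex.re_sum, Complex.re_sum] at hkey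
  have h3 : ∑ n ∈ s, ((⟪P n (f n), f n⟫_ℂ).re - ε / (s.card + 1)) ≤
      ∑ n ∈ s, (2 * (⟪f n, h n (v n)⟫_ℂ).re - (⟪g n (v n), h n (v n)⟫_ℂ).re) :=
    Finset.sum_le_sum fun n _ => (hv n).le
  rw [Finset.sum_sub_distrib, Finset.sum_sub_distrib, ← Finset.mul_sum, Finset.sum_const,
    nsmul_eq_mul] at h3
  have h4 : (s.card : ℝ) * (ε / (s.card + 1)) ≤ ε := by
    rw [mul_div_assoc', div_le_iff₀ (by positivity)]
    nlinarith
  simp only [diagonal_apply]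
  linarith

variable [∀ n, CompleteSpace (H n)] {S : ∀ n, H n →ₗ.[ℂ] H n}

theorem isNonnegSAExtension_directSum {B : ∀ n, H n →ₗ.[ℂ] H n}
    (hB : ∀ n, IsNonnegSAExtension (S n) (B n)) {x : ℝ} {Q : lp H 2 →L[ℂ] lp H 2}
    (hpos : Q.IsPositive) (hQ : IsShiftInverse (directSum B) x Q) :
    IsNonnegSAExtension (directSum S) (directSum B) :=
  ⟨directSum_mono fun n => (hB n).extends_op, hQ.isSelfAdjoint hpos,
    isNonneg_directSum fun n => (hB n).nonneg⟩

omit [∀ n, CompleteSpace (H n)] in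
theorem norm_apply_le_of_norm_sq_le {E : Type*} [NormedAddCommGroup E] [InnerProductSpace ℂ E]
    {P : E →L[ℂ] E} (hP : ∀ f, ‖P f‖ ^ 2 ≤ (⟪P f, f⟫_ℂ).re) (f : E) : ‖P f‖ ≤ ‖f‖ := by
  have h : (⟪P f, f⟫_ℂ).re ≤ ‖P f‖ * ‖f‖ := re_inner_le_norm (𝕜 := ℂ) _ _
  have := hP f
  by_contra! hlt
  nlinarith [norm_nonneg f]

theorem isFriedrichsExtension_directSum (hdense : ∀ n, Dense ((S n).domain : Set (H n)))
    (hsymm : ∀ n, (S n).IsFormalAdjoint (S n)) (hnonneg : ∀ n, IsNonneg (S n))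
    {F : ∀ n, H n →ₗ.[ℂ] H n} (hF : ∀ n, IsFriedrichsExtension (S n) (F n)) :
    IsFriedrichsExtension (directSum S) (directSum F) := by
  choose F' P hF' hinv hP hP1 using
    fun n => exists_isFriedrichsExtension (hdense n) (hsymm n) (hnonneg n)
  -- Uniqueness identifies the given extensions with the constructed ones, whose resolvents are
  -- least solutions.
  obtain rfl : F = F' := funext fun n => (hF n).unique (hF' n)
  have hP2 := fun n => norm_apply_le_of_norm_sq_le (hP1 n)
  have hpos := isPositive_diagonal hP2 fun n =>
    (ContinuousLinearMap.nonneg_iff_isPositive _).1 (hP n).nonneg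
  have hQ := isShiftInverse_directSum hinv (diagonal_apply P hP2)
  refine isFriedrichsExtension_of_forall_le
    (isNonnegSAExtension_directSum (fun n => (hF n).isExtension) hpos hQ) hQ
    fun X hX hXS => diagonal_le hP2 hP hX fun n v => ?_
  obtain ⟨h, hv⟩ := shiftMap_directSum_single S 1 n v
  rw [← hv, hXS]
  rfl

theorem isKreinExtension_directSum (hdense : ∀ n, Dense ((S n).domain : Set (H n)))
    (hsymm : ∀ n, (S n).IsFormalAdjoint (S n)) (hnonneg : ∀ n, IsNonneg (S n))
    {K : ∀ n, H n →ₗ.[ℂ] H n} (hK : ∀ n, IsKreinExtension (S n) (K n)) :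
    IsKreinExtension (directSum S) (directSum K) := by
  choose K' P hK' hinv hP hP1 using
    fun n => exists_isKreinExtension (hdense n) (hsymm n) (hnonneg n)
  obtain rfl : K = K' := funext fun n => (hK n).unique (hK' n)
  have hP2 := fun n => norm_apply_le_of_norm_sq_le (hP1 n)
  have hposP := fun n => (ContinuousLinearMap.nonneg_iff_isPositive _).1 (hP n).nonneg
  have hR2 := fun n => norm_apply_le_of_norm_sq_le (norm_sq_one_sub_apply_le (hP1 n))
  -- The resolvent of `directSum K` is the diagonal of the `1 - P n`; minimality is available for
  -- the diagonal of the `P n`.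
  have hdiag : diagonal (fun n => 1 - P n) hR2 = 1 - diagonal P hP2 :=
    ContinuousLinearMap.ext fun f => lp.ext (funext fun n => rfl)
  have hpos := isPositive_diagonal hR2 fun n => isPositive_one_sub (hposP n) (hP1 n)
  have hQ := isShiftInverse_directSum hinv (diagonal_apply _ hR2)
  rw [hdiag] at hpos hQ
  refine isKreinExtension_of_forall_le
    (isNonnegSAExtension_directSum (fun n => (hK n).isExtension) hpos hQ) hQ
    fun X hX hXS => diagonal_le hP2 hP hX fun n v => ?_
  obtain ⟨h, hv⟩ := shiftMap_directSum_single S 1 n v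
  rw [← hv, hXS]
  exact (single_mem_directSum_domain S n v).2

end DirectSum

end NonnegExt

theorem corollary3p2 {H : ℕ → Type*} [∀ n, NormedAddCommGroup (H n)]
    [∀ n, InnerProductSpace ℂ (H n)] [∀ n, CompleteSpace (H n)]
    (S : ∀ n, H n →ₗ.[ℂ] H n)
    (hdense : ∀ n, Dense ((S n).domain : Set (H n)))
    (hclosed : ∀ n, (S n).IsClosed)
    (hsymm : ∀ n, (S n).IsFormalAdjoint (S n))
    (hnonneg : ∀ n, NonnegExt.IsNonneg (S n)) :
    ((∀ n, ∃! F : H n →ₗ.[ℂ] H n, NonnegExt.IsFriedrichsExtension (S n) F) ∧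
      ∀ SF : ∀ n, H n →ₗ.[ℂ] H n,
        (∀ n, NonnegExt.IsFriedrichsExtension (S n) (SF n)) →
          ∀ F : lp H 2 →ₗ.[ℂ] lp H 2,
            NonnegExt.IsFriedrichsExtension (NonnegExt.directSum S) F ↔
              F = NonnegExt.directSum SF) ∧
    ((∀ n, ∃! K : H n →ₗ.[ℂ] H n, NonnegExt.IsKreinExtension (S n) K) ∧
      ∀ SK : ∀ n, H n →ₗ.[ℂ] H n,
        (∀ n, NonnegExt.IsKreinExtension (S n) (SK n)) →
          ∀ K : lp H 2 →ₗ.[ℂ] lp H 2,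
            NonnegExt.IsKreinExtension (NonnegExt.directSum S) K ↔
              K = NonnegExt.directSum SK) := by
  refine ⟨⟨fun n => ?_, fun SF hSF F => ?_⟩, ⟨fun n => ?_, fun SK hSK K => ?_⟩⟩
  · obtain ⟨F, -, hF, -⟩ :=
      NonnegExt.exists_isFriedrichsExtension (hdense n) (hsymm n) (hnonneg n)
    exact ⟨F, hF, fun F' hF' => hF'.unique hF⟩
  · have h := NonnegExt.isFriedrichsExtension_directSum hdense hsymm hnonneg hSF
    exact ⟨fun hF => hF.unique h, fun hF => hF ▸ h⟩
  · obtain ⟨K, -, hK, -⟩ := NonnegExt.exists_isKreinExtension (hdense n) (hsymm n) (hnonneg n)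
    exact ⟨K, hK, fun K' hK' => hK'.unique hK⟩
  · have h := NonnegExt.isKreinExtension_directSum hdense hsymm hnonneg hSK
    exact ⟨fun hK => hK.unique h, fun hK => hK ▸ h⟩
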